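/- For $z\in\mathbb{C}\setminus(-\infty,1]$, $\nu\in\mathbb{C}$ and $m\in\mathbb{N}=\{0,1,2,\dots\}$ let $P_\nu^m(z)$ be Hobson's associated Legendre function of the first kind, $$P_\nu^m(z)=(\nu+1)(\nu+2)\cdots(\nu+m)\,\frac{(z^2-1)^{m/2}}{2\pi i}\oint\frac{(t^2-1)^\nu}{2^\nu(t-z)^{\nu+m+1}}\,dt ,$$ where the contour is a circle, traversed once counterclockwise, with $1$ and $z$ inside and $-1$ outside, and $\bigl(\frac{t^2-1}{2(t-z)}\bigr)^{\nu}$ stands for $\bigl(\frac{t+1}{2}\bigr)^{\nu}\bigl(\frac{t-1}{t-z}\bigr)^{\nu}$ with principal powers; put $P_\nu=P_\nu^0$. All phases satisfy $-\pi<\arg(z\pm1)<\pi$; thus $(z^2-1)^{m/2}=(z-1)^{m/2}(z+1)^{m/2}$ with principal powers, $\left(\frac{z^2-1}{4}\right)^{m/2}=2^{-m}(z^2-1)^{m/2}$, and $\left(\frac{z-1}{z+1}\right)^{m/2}$ and $\ln\frac{z+1}{2}$ have their principal values. Let $\psi=\Gamma'/\Gamma$ be the digamma function; empty sums are $0$.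 Then for all integers $0\le m\le n$ and all $z\in\mathbb{C}\setminus(-\infty,1]$ the function $\nu\mapsto P_\nu^m(z)$ is complex differentiable at $\nu=n$, and $$\begin{aligned}\frac{\partial P_\nu^m(z)}{\partial\nu}\bigg|_{\nu=n}={}&P_n^m(z)\ln\frac{z+1}{2}\\&-(-1)^{n+m}\left(\frac{z-1}{z+1}\right)^{m/2}\sum_{k=0}^{m-1}\frac{(k+n)!\,(m-k-1)!}{k!\,(n-k)!}\left(\frac{z+1}{2}\right)^k\\&+(-1)^{n+m}\left(\frac{z^2-1}{4}\right)^{m/2}\sum_{k=0}^{n-m}(-1)^k\frac{(k+n+m)!}{k!\,(k+m)!\,(n-m-k)!}\\&\qquad\times\bigl[2\psi(k+n+m+1)-\psi(k+m+1)-\psi(k+1)\bigr]\left(\frac{z+1}{2}\right)^k .\end{aligned}$$ In particular, for $m=0$, $$\frac{\partial P_\nu(z)}{\partial\nu}\bigg|_{\nu=n}=P_n(z)\ln\frac{z+1}{2}+2\sum_{k=0}^{n}(-1)^{k+n}\frac{(k+n)!}{(k!)^2(n-k)!}\bigl[\psi(k+n+1)-\psi(k+1)\bigr]\left(\frac{z+1}{2}\right)^k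 .$$ -/

import Mathlib

open scoped Nat

/-- Centre of a circle that encloses `1` and `z` but not `-1`. -/
noncomputable def legendreCenter (z : ℂ) : ℂ :=
  (((1 + ‖z‖ ^ 2) / ((1 + z).re + ‖1 + z‖) : ℝ) : ℂ) * (1 + (1 + z) / (‖1 + z‖ : ℂ))

/-- Radius of a circle that encloses `1` and `z` but not `-1`. -/
noncomputable def legendreRadius (z : ℂ) : ℝ :=
  (‖legendreCenter z + 1‖ + max ‖legendreCenter z - 1‖ ‖legendreCenter z - z‖) / 2

/-- For `z` off the half-line `(-∞, -1]`, the circle with centre `legendreCenter z` and radius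
`legendreRadius z` has `1` and `z` strictly inside and `-1` strictly outside. -/
theorem legendreCircle_spec (z : ℂ) (hz : ∀ x : ℝ, x ≤ -1 → z ≠ (x : ℂ)) :
    (1 : ℂ) ∈ Metric.ball (legendreCenter z) (legendreRadius z) ∧
      z ∈ Metric.ball (legendreCenter z) (legendreRadius z) ∧
      (-1 : ℂ) ∉ Metric.closedBall (legendreCenter z) (legendreRadius z) := by
  have hr : 0 < ‖1 + z‖ := by
    rw [norm_pos_iff]
    intro h
    exact hz (-1) le_rfl (by push_cast; linear_combination h)
  have hsq : ‖1 + z‖ ^ 2 = (1 + z.re) ^ 2 + z.im ^ 2 := by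
    rw [Complex.sq_norm, Complex.normSq_apply]; simp; ring
  have hz2 : ‖z‖ ^ 2 = z.re ^ 2 + z.im ^ 2 := by
    rw [Complex.sq_norm, Complex.normSq_apply]; ring
  have hs : 0 < (1 + z).re + ‖1 + z‖ := by
    have h1 : -(1 + z).re ≤ ‖1 + z‖ := (neg_le_abs _).trans (Complex.abs_re_le_norm _)
    rcases h1.lt_or_eq with h | h
    · linarith
    · exfalso
      have hre : (1 + z).re = 1 + z.re := by simp
      rw [hre] at h
      have him : z.im = 0 := by
        rw [← h] at hsq
        nlinarith [sq_nonneg z.im]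
      refine hz z.re (by linarith) ?_
      apply Complex.ext <;> simp [him]
  have hre : (1 + z).re = 1 + z.re := by simp
  obtain ⟨l, hl⟩ : ∃ l : ℝ, l = (1 + ‖z‖ ^ 2) / ((1 + z).re + ‖1 + z‖) := ⟨_, rfl⟩
  have hls : l * ((1 + z.re) + ‖1 + z‖) = 1 + ‖z‖ ^ 2 := by
    rw [hl, ← hre]; field_simp
  have hlpos : 0 < l := by rw [hl]; positivity
  obtain ⟨r, hrr⟩ : ∃ r : ℝ, r = ‖1 + z‖ := ⟨_, rfl⟩
  have hc : legendreCenter z = (l : ℂ) * (1 + (1 + z) / (r : ℂ)) := by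
    rw [legendreCenter, ← hl, hrr]
  rw [← hrr] at hr hsq hls hs
  have hcre : (legendreCenter z).re = l * (1 + (1 + z.re) / r) := by
    rw [hc, Complex.re_ofReal_mul, Complex.add_re, Complex.div_ofReal_re]; simp
  have hcim : (legendreCenter z).im = l * (z.im / r) := by
    rw [hc, Complex.im_ofReal_mul, Complex.add_im, Complex.div_ofReal_im]; simp
  have hcre' : (legendreCenter z).re * r = l * (r + (1 + z.re)) := by
    rw [hcre]; field_simp
  have hcim' : (legendreCenter z).im * r = l * z.im := by
    rw [hcim]; field_simp
  have e1 : ‖legendreCenter z - 1‖ < ‖legendreCenter z + 1‖ := by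
    rw [← sq_lt_sq₀ (norm_nonneg _) (norm_nonneg _), Complex.sq_norm, Complex.sq_norm,
      Complex.normSq_apply, Complex.normSq_apply]
    have : 0 < (legendreCenter z).re := by
      by_contra! h
      rw [hre] at hs
      nlinarith [mul_pos hlpos hs]
    simp
    nlinarith
  have e2 : ‖legendreCenter z - z‖ < ‖legendreCenter z + 1‖ := by
    rw [← sq_lt_sq₀ (norm_nonneg _) (norm_nonneg _), Complex.sq_norm, Complex.sq_norm,
      Complex.normSq_apply, Complex.normSq_apply]
    have key : (legendreCenter z).re * (1 + z.re) + (legendreCenter z).im * z.im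
        = 1 + ‖z‖ ^ 2 := by
      have : ((legendreCenter z).re * (1 + z.re) + (legendreCenter z).im * z.im) * r
          = (1 + ‖z‖ ^ 2) * r := by
        linear_combination (1 + z.re) * hcre' + z.im * hcim' - l * hsq + r * hls
      exact mul_right_cancel₀ hr.ne' this
    rw [hz2] at key
    simp
    nlinarith [sq_nonneg z.re, sq_nonneg z.im]
  have e3 := max_lt e1 e2
  have h1 := le_max_left ‖legendreCenter z - 1‖ ‖legendreCenter z - z‖
  have h2 := le_max_right ‖legendreCenter z - 1‖ ‖legendreCenter z - z‖
  refine ⟨?_, ?_, ?_⟩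
  · rw [Metric.mem_ball, dist_comm, dist_eq_norm, legendreRadius]; linarith
  · rw [Metric.mem_ball, dist_comm, dist_eq_norm, legendreRadius]; linarith
  · rw [Metric.mem_closedBall, dist_comm, dist_eq_norm, legendreRadius, sub_neg_eq_add]; linarith

/-- The power `(z² - 1)^(m/2)` with the phases `-π < arg (z ± 1) < π`, that is
`(z - 1)^(m/2) (z + 1)^(m/2)` with principal powers. -/
noncomputable def sqSubOnePow (m : ℕ) (z : ℂ) : ℂ :=
  (z - 1) ^ ((m : ℂ) / 2) * (z + 1) ^ ((m : ℂ) / 2)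

/-- Hobson's associated Legendre function of the first kind `P_ν^m(z)` of complex degree `ν` and
integer order `m ≥ 0`, for `z` off the cut `(-∞, 1]`, by Schläfli's integral
`P_ν^m(z) = (ν+1)(ν+2)⋯(ν+m) (z²-1)^(m/2) / (2πi) ∮ (t²-1)^ν / (2^ν (t-z)^(ν+m+1)) dt`
over a contour that encircles `1` and `z` once counterclockwise but neither encircles `-1` nor
meets `(-∞, -1]`. The branch of `(t²-1)^ν / (2^ν (t-z)^ν)` is the one equal to
`((t+1)/2)^ν ((t-1)/(t-z))^ν` with principal powers, which is holomorphic off `(-∞, -1]` and the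
segment from `1` to `z`; so by Cauchy's theorem the circle used here may be replaced by any other
such contour. -/
noncomputable def assocLegendreP (ν : ℂ) (m : ℕ) (z : ℂ) : ℂ :=
  (ascPochhammer ℂ m).eval (ν + 1) * sqSubOnePow m z *
    ((2 * (Real.pi : ℂ) * Complex.I)⁻¹ *
      ∮ t in C(legendreCenter z, legendreRadius z),
        ((t + 1) / 2) ^ ν * ((t - 1) / (t - z)) ^ ν / (t - z) ^ (m + 1))

/-- The Legendre function of the first kind `P_ν(z) = P_ν^0(z)`. -/
noncomputable def legendreP (ν : ℂ) (z : ℂ) : ℂ := assocLegendreP ν 0 z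

open Metric Set

/-! Differentiating Schläfli's integral in `ν` multiplies the integrand by `log ((t+1)/2) + log
((t-1)/(t-z))`. Put `s = (t+1)/2` and `w = (z+1)/2`. At `ν = n` the kernel is the polynomial `s^n
(s-1)^n` over `(s-w)^(n+m+1)`, so everything reduces to moments `cauchyMoment` of order `N = n+m` of
this polynomial, alone or times one of the two logarithms, on a circle with `1` and `w` inside and
`0` outside. Expanding `(s-1)^n` leaves moments of powers times logarithms. Write `H` for harmonic
numbers.

The function `log s` is holomorphic on the disc, so the moment of `s^p log s` is a Taylor
coefficient at `w`. For `p ≥ N` it carries the factor `log w + H_p - H_(p-N)`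
(`cauchyMoment_pow_add_mul_log`). For `p < N` it is a multiple of `w^(p-N)`
(`cauchyMoment_add_pow_mul_log`), and these terms form the first sum of the theorem.

The function `log ((s-1)/(s-w))` is instead holomorphic outside the circle, with expansion `∑ (w^j -
1)/(j s^j)` at infinity. Only the part of `s^p` times this series with nonnegative powers of `s` has
a nonzero moment (`cauchyMoment_pow_mul_log_div_sub`). Two binomial sums turn the result into the
factor `H_(n+q) - H_N + H_n - H_q` (`cauchyMoment_kernel_mul_log_div_sub`).

The Pochhammer factor contributes `H_(n+m) - H_n`, which cancels the matching terms. What remains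
for `q = m+k` is `log w + 2 H_(n+m+k) - H_(m+k) - H_k`: the logarithm rebuilds `P_n^m(z) log w`, and
the harmonic numbers become digamma values. -/

theorem hasDerivAt_circleIntegral {F F' : ℂ → ℂ → ℂ} {U : Set ℂ} {x₀ c : ℂ} {R : ℝ} (hR : 0 ≤ R)
    (hU : IsOpen U) (hx₀ : x₀ ∈ U)
    (hF : ContinuousOn (Function.uncurry F) (U ×ˢ sphere c R))
    (hF' : ContinuousOn (Function.uncurry F') (U ×ˢ sphere c R))
    (h : ∀ x ∈ U, ∀ s ∈ sphere c R, HasDerivAt (fun y => F y s) (F' x s) x) :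
    HasDerivAt (fun x => ∮ s in C(c, R), F x s) (∮ s in C(c, R), F' x₀ s) x₀ := by
  obtain ⟨ε, hε, hεU⟩ := nhds_basis_closedBall.mem_iff.1 (hU.mem_nhds hx₀)
  have hcont : ∀ G : ℂ → ℂ → ℂ, ContinuousOn (Function.uncurry G) (U ×ˢ sphere c R) →
      ∀ x ∈ U, Continuous fun θ => deriv (circleMap c R) θ • G x (circleMap c R θ) := by
    intro G hG x hx
    have h1 : Continuous fun θ => G x (circleMap c R θ) :=
      hG.comp_continuous (f := fun θ => (x, circleMap c R θ)) (by fun_prop)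
        fun θ => ⟨hx, circleMap_mem_sphere c hR θ⟩
    simp only [deriv_circleMap]
    exact ((continuous_circleMap 0 R).mul continuous_const).smul h1
  -- Compactness of a closed disc times the circle gives the constant that dominates the derivative.
  obtain ⟨B, hB⟩ := ((isCompact_closedBall x₀ ε).prod (isCompact_sphere c R)).exists_bound_of_continuousOn
    (hF'.mono (prod_mono_left hεU))
  simp only [circleIntegral]
  refine (intervalIntegral.hasDerivAt_integral_of_dominated_loc_of_deriv_le
    (F' := fun x θ => deriv (circleMap c R) θ • F' x (circleMap c R θ))
    (bound := fun _ => |R| * B) (closedBall_mem_nhds x₀ hε) ?_ ?_ ?_ ?_ ?_ ?_).2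
  · filter_upwards [hU.mem_nhds hx₀] with x hx
    exact (hcont F hF x hx).aestronglyMeasurable
  · exact (hcont F hF x₀ hx₀).intervalIntegrable _ _
  · exact (hcont F' hF' x₀ hx₀).aestronglyMeasurable
  · refine .of_forall fun θ _ x hx => ?_
    rw [norm_smul]
    refine mul_le_mul (by simp) (hB (x, circleMap c R θ) ⟨hx, circleMap_mem_sphere c hR θ⟩)
      (norm_nonneg _) (abs_nonneg R)
  · exact intervalIntegrable_const
  · refine .of_forall fun θ _ x hx => ?_
    exact (h x (hεU hx) _ (circleMap_mem_sphere c hR θ)).fun_const_smul _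

/-- The normalised Cauchy integral `(2πi)⁻¹ ∮ g(s) / (s - w)^(N+1) ds` over a circle. -/
noncomputable def cauchyMoment (c : ℂ) (R : ℝ) (w : ℂ) (N : ℕ) (g : ℂ → ℂ) : ℂ :=
  (2 * (Real.pi : ℂ) * Complex.I)⁻¹ * ∮ s in C(c, R), g s / (s - w) ^ (N + 1)

/-! ### Calculus of Cauchy moments; powers and the reciprocal. -/

section Moment

variable {c w : ℂ} {R : ℝ}

theorem sub_ne_zero_of_mem_sphere (hw : w ∈ ball c R) {s : ℂ} (hs : s ∈ sphere c R) :
    s - w ≠ 0 := by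
  rw [sub_ne_zero]
  rintro rfl
  exact (mem_ball.1 hw).ne (mem_sphere.1 hs)

theorem radius_nonneg_of_mem_ball (hw : w ∈ ball c R) : 0 ≤ R := (pos_of_mem_ball hw).le

theorem continuousOn_div_sub_pow (hw : w ∈ ball c R) {g : ℂ → ℂ} (hg : ContinuousOn g (sphere c R))
    (N : ℕ) : ContinuousOn (fun s => g s / (s - w) ^ N) (sphere c R) :=
  hg.div (by fun_prop) fun _ hs => pow_ne_zero _ (sub_ne_zero_of_mem_sphere hw hs)

theorem circleIntegrable_div_sub_pow (hw : w ∈ ball c R) {g : ℂ → ℂ}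
    (hg : ContinuousOn g (sphere c R)) (N : ℕ) :
    CircleIntegrable (fun s => g s / (s - w) ^ N) c R :=
  (continuousOn_div_sub_pow hw hg N).circleIntegrable (radius_nonneg_of_mem_ball hw)

theorem cauchyMoment_congr (hR : 0 ≤ R) {N : ℕ} {f g : ℂ → ℂ} (h : EqOn f g (sphere c R)) :
    cauchyMoment c R w N f = cauchyMoment c R w N g := by
  unfold cauchyMoment
  congr 1
  exact circleIntegral.integral_congr hR fun s hs => by simp only [h hs]

theorem cauchyMoment_add (hw : w ∈ ball c R) (N : ℕ) {f g : ℂ → ℂ}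
    (hf : ContinuousOn f (sphere c R)) (hg : ContinuousOn g (sphere c R)) :
    cauchyMoment c R w N (fun s => f s + g s) = cauchyMoment c R w N f + cauchyMoment c R w N g := by
  unfold cauchyMoment
  simp only [add_div]
  rw [circleIntegral.integral_add (circleIntegrable_div_sub_pow hw hf _)
    (circleIntegrable_div_sub_pow hw hg _), mul_add]

theorem cauchyMoment_sub (hw : w ∈ ball c R) (N : ℕ) {f g : ℂ → ℂ}
    (hf : ContinuousOn f (sphere c R)) (hg : ContinuousOn g (sphere c R)) :
    cauchyMoment c R w N (fun s => f s - g s) = cauchyMoment c R w N f - cauchyMoment c R w N g := by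
  unfold cauchyMoment
  simp only [sub_div]
  rw [circleIntegral.integral_sub (circleIntegrable_div_sub_pow hw hf _)
    (circleIntegrable_div_sub_pow hw hg _), mul_sub]

theorem cauchyMoment_const_mul (N : ℕ) (a : ℂ) (f : ℂ → ℂ) :
    cauchyMoment c R w N (fun s => a * f s) = a * cauchyMoment c R w N f := by
  unfold cauchyMoment
  simp only [mul_div_assoc]
  rw [circleIntegral.integral_const_mul]
  ring

theorem cauchyMoment_zero (N : ℕ) : cauchyMoment c R w N (fun _ => 0) = 0 := by
  simp [cauchyMoment, circleIntegral]

theorem cauchyMoment_sum (hw : w ∈ ball c R) (N : ℕ) {ι : Type*} (t : Finset ι) {f : ι → ℂ → ℂ}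
    (hf : ∀ i ∈ t, ContinuousOn (f i) (sphere c R)) :
    cauchyMoment c R w N (fun s => ∑ i ∈ t, f i s) = ∑ i ∈ t, cauchyMoment c R w N (f i) := by
  classical
  induction t using Finset.induction_on with
  | empty => simpa using cauchyMoment_zero N
  | insert a t ha ih =>
    simp only [Finset.sum_insert ha]
    rw [cauchyMoment_add hw N (hf a (by simp)) (continuousOn_finsetSum _ fun i hi =>
      hf i (by simp [hi])), ih fun i hi => hf i (by simp [hi])]

/-- The derivative of `g / (s-w)^(N+1)` integrates to zero over the closed circle. Only
differentiability on the circle itself is needed, so this also applies to `log ((s-a)/(s-w))`, which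
is singular inside. -/
theorem cauchyMoment_deriv (hw : w ∈ ball c R) (N : ℕ) {g g' : ℂ → ℂ}
    (hg : ∀ s ∈ sphere c R, HasDerivAt g (g' s) s) (hg' : ContinuousOn g' (sphere c R)) :
    cauchyMoment c R w N g' = (N + 1) * cauchyMoment c R w (N + 1) g := by
  have hgc : ContinuousOn g (sphere c R) := fun s hs => (hg s hs).continuousAt.continuousWithinAt
  have key : ∮ s in C(c, R), (g' s / (s - w) ^ (N + 1) - (N + 1) * (g s / (s - w) ^ (N + 2))) = 0 := by
    refine circleIntegral.integral_eq_zero_of_hasDerivWithinAt (radius_nonneg_of_mem_ball hw)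
      (f := fun s => g s / (s - w) ^ (N + 1)) fun s hs => HasDerivAt.hasDerivWithinAt ?_
    have hne := sub_ne_zero_of_mem_sphere hw hs
    have h1 : HasDerivAt (fun s : ℂ => (s - w) ^ (N + 1)) ((N + 1) * (s - w) ^ N) s := by
      simpa using ((hasDerivAt_id s).sub_const w).fun_pow (N + 1)
    refine ((hg s hs).fun_div h1 (pow_ne_zero _ hne)).congr_deriv ?_
    field_simp
    ring
  rw [circleIntegral.integral_sub (circleIntegrable_div_sub_pow hw hg' _)
    ((continuousOn_const.fun_mul (continuousOn_div_sub_pow hw hgc _)).circleIntegrable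
      (radius_nonneg_of_mem_ball hw)), circleIntegral.integral_const_mul, sub_eq_zero] at key
  unfold cauchyMoment
  rw [key]
  ring

theorem cauchyMoment_sub_mul (hw : w ∈ ball c R) (N : ℕ) (g : ℂ → ℂ) :
    cauchyMoment c R w (N + 1) (fun s => (s - w) * g s) = cauchyMoment c R w N g := by
  unfold cauchyMoment
  congr 1
  refine circleIntegral.integral_congr (radius_nonneg_of_mem_ball hw) fun s hs => ?_
  have hne := sub_ne_zero_of_mem_sphere hw hs
  simp only
  field_simp
  ring

theorem cauchyMoment_zero_eq (hw : w ∈ ball c R) {g : ℂ → ℂ} {g' : ℂ → ℂ}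
    (hg : ∀ s ∈ closedBall c R, HasDerivAt g (g' s) s) : cauchyMoment c R w 0 g = g w := by
  have hd : DifferentiableOn ℂ g (closedBall c R) := fun s hs =>
    (hg s hs).differentiableAt.differentiableWithinAt
  have := hd.circleIntegral_sub_inv_smul hw
  unfold cauchyMoment
  simp only [zero_add, pow_one, div_eq_inv_mul]
  simp only [smul_eq_mul] at this
  rw [this, ← mul_assoc, inv_mul_cancel₀ Complex.two_pi_I_ne_zero, one_mul]

/-- This is the `N`-th Taylor coefficient of `s^p` at `w`. For `p < N` the binomial coefficient
vanishes, so the truncated exponent is harmless. -/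
theorem cauchyMoment_pow (hw : w ∈ ball c R) (N p : ℕ) :
    cauchyMoment c R w N (fun s => s ^ p) = (p.choose N : ℂ) * w ^ (p - N) := by
  induction N generalizing p with
  | zero =>
    rw [cauchyMoment_zero_eq hw fun s _ => hasDerivAt_pow p s]
    simp
  | succ N ih =>
    have h := cauchyMoment_deriv hw N (fun s _ => hasDerivAt_pow p s)
      (by fun_prop : ContinuousOn (fun s : ℂ => (p : ℂ) * s ^ (p - 1)) (sphere c R))
    rw [cauchyMoment_const_mul, ih] at h
    have hN : (N + 1 : ℂ) ≠ 0 := by exact_mod_cast N.succ_ne_zero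
    rw [← mul_right_inj' hN, ← h]
    rcases p with _ | p
    · simp
    · have := Nat.add_one_mul_choose_eq p N
      have h2 : ((p : ℂ) + 1) * p.choose N = (p + 1).choose (N + 1) * (N + 1) := by
        exact_mod_cast this
      simp only [Nat.add_sub_cancel, Nat.add_sub_add_right]
      push_cast
      linear_combination w ^ (p - N) * h2

theorem ne_zero_of_zero_notMem {S : Set ℂ} (h0 : (0 : ℂ) ∉ S) {s : ℂ} (hs : s ∈ S) : s ≠ 0 :=
  fun h => h0 (h ▸ hs)

theorem cauchyMoment_one_succ (hw : w ∈ ball c R) (N : ℕ) :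
    cauchyMoment c R w (N + 1) (fun _ => 1) = 0 := by
  simpa using cauchyMoment_pow hw (N + 1) 0

theorem cauchyMoment_inv (hw : w ∈ ball c R) (h0 : (0 : ℂ) ∉ closedBall c R) (N : ℕ) :
    cauchyMoment c R w N (fun s => s⁻¹) = (-1) ^ N / w ^ (N + 1) := by
  have hw0 : w ≠ 0 := ne_zero_of_zero_notMem h0 (ball_subset_closedBall hw)
  induction N with
  | zero =>
    rw [cauchyMoment_zero_eq hw fun s hs => hasDerivAt_inv (ne_zero_of_zero_notMem h0 hs)]
    simp
  | succ N ih =>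
    have hs0 : ∀ s ∈ sphere c R, s ≠ 0 := fun s hs =>
      ne_zero_of_zero_notMem h0 (sphere_subset_closedBall hs)
    have hc : ContinuousOn (fun s : ℂ => s⁻¹) (sphere c R) := continuousOn_id.inv₀ hs0
    have h1 := cauchyMoment_one_succ hw N
    -- The identity `1 = (s-w) s⁻¹ + w s⁻¹` relates the moments of `s⁻¹` of orders `N` and `N+1`.
    rw [cauchyMoment_congr (radius_nonneg_of_mem_ball hw)
      (g := fun s => (s - w) * s⁻¹ + w * s⁻¹) (fun s hs => by have := hs0 s hs; simp only; field_simp; ring),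
      cauchyMoment_add hw _ (by fun_prop) (by fun_prop), cauchyMoment_sub_mul hw,
      cauchyMoment_const_mul, ih] at h1
    rw [← mul_right_inj' hw0, eq_neg_of_add_eq_zero_right h1]
    field_simp
    ring

end Moment

/-! ### Moments of powers times `log s` and times `log ((s-a)/(s-w))`. -/

section LogMoment

variable {c w a : ℂ} {R : ℝ}

theorem cast_choose_succ_mul (p N : ℕ) :
    ((p : ℂ) + 1) * p.choose N = (p + 1).choose (N + 1) * (N + 1) := by
  exact_mod_cast Nat.add_one_mul_choose_eq p N

theorem cast_harmonic_succ (n : ℕ) :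
    ((harmonic (n + 1) : ℚ) : ℂ) = harmonic n + ((n : ℂ) + 1)⁻¹ := by
  rw [harmonic_succ]
  push_cast
  rfl

theorem hasDerivAt_pow_succ_mul_log (p : ℕ) {s : ℂ} (hs : s ∈ Complex.slitPlane) :
    HasDerivAt (fun s : ℂ => s ^ (p + 1) * Complex.log s)
      ((p + 1) * (s ^ p * Complex.log s) + s ^ p) s := by
  have h0 := Complex.slitPlane_ne_zero hs
  refine ((hasDerivAt_pow (p + 1) s).fun_mul (Complex.hasDerivAt_log hs)).congr_deriv ?_
  rw [Nat.add_sub_cancel]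
  push_cast
  field_simp
  ring

theorem continuousOn_pow_mul_log (hS : sphere c R ⊆ Complex.slitPlane) (p : ℕ) :
    ContinuousOn (fun s : ℂ => s ^ p * Complex.log s) (sphere c R) :=
  ContinuousOn.mul (by fun_prop) fun _ hs => (continuousAt_clog (hS hs)).continuousWithinAt

/-- Integration by parts raises the order and the exponent together and keeps their difference. The
recursion therefore starts from order `0` when the exponent is at least the order, and from exponent
`0` otherwise. -/
theorem cauchyMoment_succ_pow_succ_mul_log (hw : w ∈ ball c R)
    (hS : closedBall c R ⊆ Complex.slitPlane) (N p : ℕ) :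
    (N + 1) * cauchyMoment c R w (N + 1) (fun s => s ^ (p + 1) * Complex.log s) =
      (p + 1) * cauchyMoment c R w N (fun s => s ^ p * Complex.log s) +
        p.choose N * w ^ (p - N) := by
  have hS' := sphere_subset_closedBall.trans hS
  have hc := continuousOn_pow_mul_log hS' p
  rw [← cauchyMoment_deriv hw N (fun s hs => hasDerivAt_pow_succ_mul_log p (hS' hs)) (by fun_prop),
    cauchyMoment_add hw _ (by fun_prop) (by fun_prop), cauchyMoment_const_mul, cauchyMoment_pow hw]

theorem cauchyMoment_pow_add_mul_log (hw : w ∈ ball c R)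
    (hS : closedBall c R ⊆ Complex.slitPlane) (N k : ℕ) :
    cauchyMoment c R w N (fun s => s ^ (N + k) * Complex.log s) =
      (N + k).choose N * w ^ k * (Complex.log w + harmonic (N + k) - harmonic k) := by
  induction N with
  | zero =>
    rw [cauchyMoment_zero_eq hw fun s hs =>
      (hasDerivAt_pow _ s).fun_mul (Complex.hasDerivAt_log (hS hs))]
    simp
  | succ N ih =>
    have h := cauchyMoment_succ_pow_succ_mul_log hw hS N (N + k)
    have hN : (N + 1 : ℂ) ≠ 0 := by exact_mod_cast N.succ_ne_zero
    have hNk : ((N : ℂ) + k + 1) ≠ 0 := by exact_mod_cast (N + k).succ_ne_zero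
    rw [ih, Nat.add_sub_cancel_left] at h
    rw [← mul_right_inj' hN, Nat.add_right_comm, h, cast_harmonic_succ]
    have := cast_choose_succ_mul (N + k) N
    push_cast at this ⊢
    field_simp
    linear_combination w ^ k * (((N : ℂ) + k + 1) *
      (Complex.log w + harmonic (N + k) - harmonic k) + 1) * this

theorem cauchyMoment_add_pow_mul_log (hw : w ∈ ball c R)
    (hS : closedBall c R ⊆ Complex.slitPlane) (p j : ℕ) :
    cauchyMoment c R w (p + 1 + j) (fun s => s ^ p * Complex.log s) =
      (-1) ^ j * (p ! * j ! / (p + 1 + j)!) / w ^ (j + 1) := by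
  have hS' := sphere_subset_closedBall.trans hS
  induction p with
  | zero =>
    have h := cauchyMoment_deriv hw j (fun s hs => Complex.hasDerivAt_log (hS' hs))
      (continuousOn_id.inv₀ fun s hs => Complex.slitPlane_ne_zero (hS' hs))
    have hj : (j + 1 : ℂ) ≠ 0 := by exact_mod_cast j.succ_ne_zero
    have hj' : (j ! : ℂ) ≠ 0 := by exact_mod_cast j.factorial_ne_zero
    rw [cauchyMoment_inv hw fun h => Complex.slitPlane_ne_zero (hS h) rfl] at h
    simp only [pow_zero, one_mul, zero_add, Nat.factorial_zero, add_comm 1 j]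
    rw [← mul_right_inj' hj, ← h, Nat.factorial_succ]
    push_cast
    field_simp
  | succ p ih =>
    have h := cauchyMoment_succ_pow_succ_mul_log hw hS (p + 1 + j) p
    have hN : (p + 1 + j + 1 : ℂ) ≠ 0 := by exact_mod_cast (p + 1 + j).succ_ne_zero
    have hf : ((p + 1 + j)! : ℂ) ≠ 0 := by exact_mod_cast (p + 1 + j).factorial_ne_zero
    -- The order exceeds the exponent, so the inhomogeneous term of the recursion vanishes.
    rw [ih, Nat.choose_eq_zero_of_lt (by omega)] at h
    rw [show p + 1 + 1 + j = p + 1 + j + 1 by omega]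
    push_cast at h
    rw [← mul_right_inj' hN, h, Nat.factorial_succ (p + 1 + j), Nat.factorial_succ p]
    push_cast
    field_simp
    ring

/-- If the quotient were a nonpositive real, `s` would lie on the segment from `a` to `w`, which
stays in the open disc by convexity. Hence the principal logarithm of the quotient is single-valued
and smooth on the whole circle. -/
theorem div_sub_mem_slitPlane (ha : a ∈ ball c R) (hw : w ∈ ball c R) {s : ℂ}
    (hs : s ∈ sphere c R) : (s - a) / (s - w) ∈ Complex.slitPlane := by
  have hsw := sub_ne_zero_of_mem_sphere hw hs
  rw [Complex.mem_slitPlane_iff_not_le_zero]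
  intro h
  obtain ⟨hre, him⟩ := Complex.le_def.1 h
  obtain ⟨x, hx⟩ : ∃ x : ℝ, x = -((s - a) / (s - w)).re := ⟨_, rfl⟩
  have hx0 : 0 ≤ x := by simp only [Complex.zero_re] at hre; linarith
  have hxe : (s - a) / (s - w) = -(x : ℂ) := by
    apply Complex.ext
    · simp [hx]
    · simpa using him
  rw [div_eq_iff hsw] at hxe
  have hmem : (1 / (1 + x)) • a + (x / (1 + x)) • w ∈ ball c R :=
    convex_ball c R ha hw (by positivity) (by positivity) (by field_simp)
  have hx1 : (1 + x : ℂ) ≠ 0 := by exact_mod_cast (by positivity : (1 + x) ≠ 0)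
  have : s = (1 / (1 + x)) • a + (x / (1 + x)) • w := by
    simp only [Complex.real_smul]
    push_cast
    field_simp
    linear_combination hxe
  rw [← this] at hmem
  exact (mem_ball.1 hmem).ne (mem_sphere.1 hs)

theorem hasDerivAt_log_div_sub (ha : a ∈ ball c R) (hw : w ∈ ball c R) {s : ℂ}
    (hs : s ∈ sphere c R) :
    HasDerivAt (fun s => Complex.log ((s - a) / (s - w))) ((s - a)⁻¹ - (s - w)⁻¹) s := by
  have h1 := sub_ne_zero_of_mem_sphere hw hs
  have h2 := sub_ne_zero_of_mem_sphere ha hs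
  refine ((((hasDerivAt_id s).sub_const a).fun_div ((hasDerivAt_id s).sub_const w) h1).clog
    (div_sub_mem_slitPlane ha hw hs)).congr_deriv ?_
  simp only [id]
  field_simp

theorem hasDerivAt_log_div_sub_right (ha : a ∈ ball c R) (hw : w ∈ ball c R) {s : ℂ}
    (hs : s ∈ sphere c R) :
    HasDerivAt (fun w => Complex.log ((s - a) / (s - w))) (s - w)⁻¹ w := by
  have h1 := sub_ne_zero_of_mem_sphere hw hs
  have h2 := sub_ne_zero_of_mem_sphere ha hs
  refine (((hasDerivAt_const w (s - a)).fun_div ((hasDerivAt_id w).const_sub s) h1).clog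
    (div_sub_mem_slitPlane ha hw hs)).congr_deriv ?_
  simp only [id]
  field_simp
  ring

theorem continuousOn_log_div_sub (ha : a ∈ ball c R) (hw : w ∈ ball c R) :
    ContinuousOn (fun s => Complex.log ((s - a) / (s - w))) (sphere c R) := fun _ hs =>
  (hasDerivAt_log_div_sub ha hw hs).continuousAt.continuousWithinAt

theorem continuousOn_inv_sub (ha : a ∈ ball c R) :
    ContinuousOn (fun s => (s - a)⁻¹) (sphere c R) :=
  ContinuousOn.inv₀ (by fun_prop) fun _ hs => sub_ne_zero_of_mem_sphere ha hs

/-- The integrand is holomorphic outside the circle and decays at least like `s⁻²`. The proof is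
algebraic: `(s-w)/(s-a) + (w-a)/(s-a) = 1` gives an induction on `N` when `a ≠ w`. -/
theorem cauchyMoment_inv_sub (ha : a ∈ ball c R) (hw : w ∈ ball c R) (N : ℕ) :
    cauchyMoment c R w N (fun s => (s - a)⁻¹) = 0 := by
  have hR := radius_nonneg_of_mem_ball hw
  by_cases haw : a = w
  · subst haw
    rw [← cauchyMoment_sub_mul ha, cauchyMoment_congr hR (g := fun _ => 1) fun s hs =>
      mul_inv_cancel₀ (sub_ne_zero_of_mem_sphere ha hs), cauchyMoment_one_succ ha]
  have hwa : w - a ≠ 0 := sub_ne_zero.2 (Ne.symm haw)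
  have hc := continuousOn_inv_sub ha
  have key : ∀ s ∈ sphere c R, (s - w) * (s - a)⁻¹ + (w - a) * (s - a)⁻¹ = 1 := fun s hs => by
    have := sub_ne_zero_of_mem_sphere ha hs
    field_simp
    ring
  induction N with
  | zero =>
    have h1 : cauchyMoment c R w 0 (fun s => (s - w) * (s - a)⁻¹) = 1 := by
      have h2 := cauchyMoment_pow ha 0 0
      simp only [pow_zero, Nat.choose_self, Nat.cast_one, mul_one, Nat.sub_self] at h2
      rw [← h2]
      unfold cauchyMoment
      congr 1
      refine circleIntegral.integral_congr hR fun s hs => ?_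
      have := sub_ne_zero_of_mem_sphere ha hs
      have := sub_ne_zero_of_mem_sphere hw hs
      simp only [zero_add, pow_one]
      field_simp
    have h := cauchyMoment_pow hw 0 0
    simp only [pow_zero, Nat.choose_self, Nat.cast_one, mul_one, Nat.sub_self] at h
    rw [← cauchyMoment_congr hR key, cauchyMoment_add hw _ (by fun_prop) (by fun_prop),
      cauchyMoment_const_mul, h1] at h
    simpa [hwa] using h
  | succ N ih =>
    have h := cauchyMoment_one_succ hw N
    rw [← cauchyMoment_congr hR key, cauchyMoment_add hw _ (by fun_prop) (by fun_prop),
      cauchyMoment_sub_mul hw, cauchyMoment_const_mul, ih] at h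
    simpa [hwa] using h

theorem cauchyMoment_succ_log_div_sub (ha : a ∈ ball c R) (hw : w ∈ ball c R) (N : ℕ) :
    cauchyMoment c R w (N + 1) (fun s => Complex.log ((s - a) / (s - w))) = 0 := by
  have hca := continuousOn_inv_sub ha
  have hcw := continuousOn_inv_sub hw
  have h := cauchyMoment_deriv hw N (fun s hs => hasDerivAt_log_div_sub ha hw hs) (by fun_prop)
  rw [cauchyMoment_sub hw _ hca hcw, cauchyMoment_inv_sub ha hw, cauchyMoment_inv_sub hw hw] at h
  have hN : (N + 1 : ℂ) ≠ 0 := by exact_mod_cast N.succ_ne_zero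
  simpa [hN] using h.symm

theorem continuousOn_uncurry_log_div_sub (ha : a ∈ ball c R) :
    ContinuousOn (fun x : ℂ × ℂ => Complex.log ((x.2 - a) / (x.2 - x.1)))
      (ball c R ×ˢ sphere c R) :=
  ContinuousOn.clog (ContinuousOn.div (by fun_prop) (by fun_prop) fun _ hx =>
    sub_ne_zero_of_mem_sphere hx.1 hx.2) fun _ hx => div_sub_mem_slitPlane ha hx.1 hx.2

/-- As a function of `w` this moment has derivative equal to the order-one moment of `1 + log
((s-a)/(s-w))`, which is zero. It is therefore constant on the disc, and at `w = a` the integrand is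
`log 1 = 0`. -/
theorem cauchyMoment_zero_log_div_sub (ha : a ∈ ball c R) (hw : w ∈ ball c R) :
    cauchyMoment c R w 0 (fun s => Complex.log ((s - a) / (s - w))) = 0 := by
  have hR := radius_nonneg_of_mem_ball hw
  have hcont := continuousOn_uncurry_log_div_sub ha
  have hdiv : ∀ (N : ℕ) {f : ℂ × ℂ → ℂ}, ContinuousOn f (ball c R ×ˢ sphere c R) →
      ContinuousOn (fun x => f x / (x.2 - x.1) ^ N) (ball c R ×ˢ sphere c R) := fun N f hf =>
    hf.div (by fun_prop) fun x hx => pow_ne_zero N (sub_ne_zero_of_mem_sphere hx.1 hx.2)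
  have hd : ∀ v ∈ ball c R, HasDerivAt
      (fun v => cauchyMoment c R v 0 (fun s => Complex.log ((s - a) / (s - v)))) 0 v := by
    intro v hv
    have h := (hasDerivAt_circleIntegral hR isOpen_ball hv
      (F := fun v s => Complex.log ((s - a) / (s - v)) / (s - v) ^ (0 + 1))
      (F' := fun v s => (1 + Complex.log ((s - a) / (s - v))) / (s - v) ^ (1 + 1))
      (hdiv (0 + 1) hcont) (hdiv (1 + 1) (continuousOn_const.fun_add hcont))
      (fun v hv s hs => by
        have hsv := sub_ne_zero_of_mem_sphere hv hs
        simp only [zero_add, pow_one]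
        refine ((hasDerivAt_log_div_sub_right ha hv hs).fun_div
          ((hasDerivAt_id v).const_sub s) hsv).congr_deriv ?_
        simp only [id]
        field_simp
        ring)).const_mul (2 * (Real.pi : ℂ) * Complex.I)⁻¹
    refine h.congr_deriv ?_
    change cauchyMoment c R v 1 _ = 0
    rw [cauchyMoment_add hv _ (by fun_prop) (continuousOn_log_div_sub ha hv),
      cauchyMoment_one_succ hv, cauchyMoment_succ_log_div_sub ha hv, add_zero]
  have := (convex_ball c R).is_const_of_fderivWithin_eq_zero (𝕜 := ℂ)
    (f := fun v => cauchyMoment c R v 0 (fun s => Complex.log ((s - a) / (s - v))))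
    (fun v hv => (hd v hv).differentiableAt.differentiableWithinAt)
    (fun v hv => by
      rw [fderivWithin_of_isOpen isOpen_ball hv]
      ext
      simpa using (hd v hv).deriv) hw ha
  rw [this, cauchyMoment_congr hR (g := fun _ => 0) fun s hs => by
    simp [div_self (sub_ne_zero_of_mem_sphere ha hs)], cauchyMoment_zero]

theorem cauchyMoment_log_div_sub (ha : a ∈ ball c R) (hw : w ∈ ball c R) (N : ℕ) :
    cauchyMoment c R w N (fun s => Complex.log ((s - a) / (s - w))) = 0 := by
  cases N with
  | zero => exact cauchyMoment_zero_log_div_sub ha hw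
  | succ N => exact cauchyMoment_succ_log_div_sub ha hw N

/-- The factor `s-w` cancels the denominator. Integrating by parts against `s^(p+1)` then leaves
`s^(p+1)/(s-a) - s^(p+1)/(s-w)`, which Cauchy's formula evaluates. -/
theorem cauchyMoment_zero_sub_mul_pow_mul_log_div_sub (ha : a ∈ ball c R) (hw : w ∈ ball c R)
    (p : ℕ) :
    cauchyMoment c R w 0 (fun s => (s - w) * (s ^ p * Complex.log ((s - a) / (s - w)))) =
      (w ^ (p + 1) - a ^ (p + 1)) / (p + 1) := by
  have hR := radius_nonneg_of_mem_ball hw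
  have hp : (p + 1 : ℂ) ≠ 0 := by exact_mod_cast p.succ_ne_zero
  have hcL := continuousOn_log_div_sub ha hw
  have h1 : (2 * (Real.pi : ℂ) * Complex.I)⁻¹ *
      ∮ s in C(c, R), ((p + 1) * (s ^ p * Complex.log ((s - a) / (s - w))) +
        (s ^ (p + 1) / (s - a) ^ 1 - s ^ (p + 1) / (s - w) ^ 1)) = 0 := by
    rw [circleIntegral.integral_eq_zero_of_hasDerivWithinAt hR
      (f := fun s => s ^ (p + 1) * Complex.log ((s - a) / (s - w))), mul_zero]
    intro s hs
    refine (((hasDerivAt_pow (p + 1) s).fun_mul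
      (hasDerivAt_log_div_sub ha hw hs)).congr_deriv ?_).hasDerivWithinAt
    have := sub_ne_zero_of_mem_sphere ha hs
    have := sub_ne_zero_of_mem_sphere hw hs
    rw [Nat.add_sub_cancel]
    push_cast
    field_simp
  have hpc : ContinuousOn (fun s : ℂ => s ^ (p + 1)) (sphere c R) := by fun_prop
  rw [circleIntegral.integral_add (ContinuousOn.circleIntegrable hR (by fun_prop))
    (((continuousOn_div_sub_pow ha hpc 1).fun_sub
      (continuousOn_div_sub_pow hw hpc 1)).circleIntegrable hR),
    circleIntegral.integral_sub (circleIntegrable_div_sub_pow ha hpc 1)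
      (circleIntegrable_div_sub_pow hw hpc 1), circleIntegral.integral_const_mul] at h1
  have h2 := cauchyMoment_pow ha 0 (p + 1)
  have h3 := cauchyMoment_pow hw 0 (p + 1)
  unfold cauchyMoment at h2 h3 ⊢
  simp only [zero_add, Nat.choose_zero_right, Nat.cast_one, one_mul, Nat.sub_zero] at h2 h3
  rw [circleIntegral.integral_congr hR (g := fun s => s ^ p * Complex.log ((s - a) / (s - w)))
    fun s hs => by
      have := sub_ne_zero_of_mem_sphere hw hs
      simp only [zero_add, pow_one]
      field_simp]
  rw [eq_div_iff hp]
  linear_combination h1 - h2 + h3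

/-- The index `i` stands for the term `(w^(i+1) - a^(i+1)) / ((i+1) s^(i+1))` of the logarithm's
expansion at infinity, and the binomial factor is the moment of `s^(p-1-i)`. The induction on `p`
writes `s = (s-w) + w` and uses Pascal's rule. -/
theorem cauchyMoment_pow_mul_log_div_sub (ha : a ∈ ball c R) (hw : w ∈ ball c R) (N p : ℕ) :
    cauchyMoment c R w N (fun s => s ^ p * Complex.log ((s - a) / (s - w))) =
      ∑ i ∈ Finset.range p, ((p - 1 - i).choose N : ℂ) * w ^ (p - 1 - i - N) *
        ((w ^ (i + 1) - a ^ (i + 1)) / (i + 1)) := by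
  have hR := radius_nonneg_of_mem_ball hw
  have hcL := continuousOn_log_div_sub ha hw
  induction p generalizing N with
  | zero => simpa using cauchyMoment_log_div_sub ha hw N
  | succ p ih =>
    rw [cauchyMoment_congr hR (g := fun s =>
        (s - w) * (s ^ p * Complex.log ((s - a) / (s - w))) +
          w * (s ^ p * Complex.log ((s - a) / (s - w)))) fun s _ => by ring,
      cauchyMoment_add hw _ (by fun_prop) (by fun_prop), cauchyMoment_const_mul, ih,
      Finset.mul_sum, Finset.sum_range_succ]
    simp only [Nat.add_sub_cancel, Nat.sub_self]
    cases N with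
    | zero =>
      rw [cauchyMoment_zero_sub_mul_pow_mul_log_div_sub ha hw, add_comm]
      simp only [Nat.choose_zero_right, Nat.cast_one, one_mul, Nat.sub_zero, pow_zero]
      congr 1
      refine Finset.sum_congr rfl fun i hi => ?_
      rw [Finset.mem_range] at hi
      rw [show p - i = p - 1 - i + 1 by omega, pow_succ]
      ring
    | succ N =>
      rw [cauchyMoment_sub_mul hw, ih, ← Finset.sum_add_distrib]
      simp only [Nat.choose_zero_succ, Nat.cast_zero, zero_mul, add_zero]
      refine Finset.sum_congr rfl fun i hi => ?_
      rw [Finset.mem_range] at hi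
      obtain ⟨q, rfl⟩ : ∃ q, p = q + 1 + i := ⟨p - 1 - i, by omega⟩
      simp only [Nat.add_sub_cancel, show q + 1 + i - 1 - i = q by omega,
        Nat.choose_succ_succ, Nat.add_sub_add_right]
      rcases lt_or_ge q (N + 1) with h | h
      · rw [Nat.choose_eq_zero_of_lt h]
        push_cast
        ring
      · rw [show q - N = q - (N + 1) + 1 by omega, pow_succ]
        push_cast
        ring

end LogMoment

/-! ### Binomial sums giving harmonic numbers; digamma and Pochhammer values at integers. -/

section HarmonicSums

theorem sum_range_choose_div_succ (M N : ℕ) :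
    ∑ i ∈ Finset.range M, ((M - 1 - i).choose N : ℂ) / (i + 1) =
      M.choose N * (harmonic M - harmonic N) := by
  induction M generalizing N with
  | zero => cases N <;> simp
  | succ M ih =>
    cases N with
    | zero =>
      have h := ih 0
      simp only [Nat.choose_zero_right, Nat.cast_one, one_mul, harmonic_zero, Rat.cast_zero,
        sub_zero] at h ⊢
      rw [Finset.sum_range_succ, h, cast_harmonic_succ, one_div]
    | succ N =>
      rw [Finset.sum_range_succ, Nat.add_sub_cancel, Nat.sub_self, Nat.choose_zero_succ,
        Finset.sum_congr rfl (g := fun i => ((M - 1 - i).choose N : ℂ) / (i + 1) +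
          ((M - 1 - i).choose (N + 1) : ℂ) / (i + 1)) fun i hi => by
        rw [Finset.mem_range] at hi
        rw [show M - i = M - 1 - i + 1 by omega, Nat.choose_succ_succ]
        push_cast
        ring, Finset.sum_add_distrib, ih, ih, cast_harmonic_succ, cast_harmonic_succ]
      have h1 := cast_choose_succ_mul M N
      have hM : (M + 1 : ℂ) ≠ 0 := by exact_mod_cast M.succ_ne_zero
      have hN : (N + 1 : ℂ) ≠ 0 := by exact_mod_cast N.succ_ne_zero
      have h2 : ((M + 1).choose (N + 1) : ℂ) * ((M : ℂ) + 1)⁻¹ = M.choose N * ((N : ℂ) + 1)⁻¹ := by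
        field_simp
        linear_combination -h1
      rw [Nat.choose_succ_succ] at h2 ⊢
      push_cast at h2 ⊢
      linear_combination -h2

theorem sum_range_neg_one_pow_mul_choose_succ (n : ℕ) :
    ∑ j ∈ Finset.range (n + 1), (-1) ^ j * ((n + 1).choose (j + 1) : ℂ) = 1 := by
  have h := add_pow (-1 : ℂ) 1 (n + 1)
  rw [Finset.sum_range_succ'] at h
  simp only [neg_add_cancel, one_pow, mul_one, pow_zero, Nat.choose_zero_right, Nat.cast_one,
    pow_succ _ (_ : ℕ), mul_zero, mul_neg, neg_mul, Finset.sum_neg_distrib] at h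
  linear_combination h

theorem sum_range_neg_one_pow_mul_choose_div_succ (n K : ℕ) :
    ∑ j ∈ Finset.range n, (-1) ^ j * (n.choose (K + 1 + j) : ℂ) / (j + 1) =
      n.choose K * (harmonic n - harmonic K) := by
  induction n generalizing K with
  | zero => cases K <;> simp
  | succ n ih =>
    have hsplit : ∀ K, ∑ j ∈ Finset.range (n + 1),
        (-1) ^ j * ((n + 1).choose (K + 1 + j) : ℂ) / (j + 1) =
          ∑ j ∈ Finset.range (n + 1), (-1) ^ j * (n.choose (K + j) : ℂ) / (j + 1) +
            n.choose K * (harmonic n - harmonic K) := by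
      intro K
      -- The added term `j = n` is zero and brings both sums to the same range, so that Pascal's
      -- rule applies termwise.
      rw [← ih, ← add_zero (∑ j ∈ Finset.range n, _),
        show (0 : ℂ) = (-1) ^ n * (n.choose (K + 1 + n) : ℂ) / (n + 1) by
          rw [Nat.choose_eq_zero_of_lt (by omega)]; simp,
        ← Finset.sum_range_succ (fun j : ℕ => (-1) ^ j * (n.choose (K + 1 + j) : ℂ) / (j + 1)),
        ← Finset.sum_add_distrib]
      refine Finset.sum_congr rfl fun j _ => ?_
      rw [show K + 1 + j = K + j + 1 by omega, Nat.choose_succ_succ]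
      push_cast
      ring
    rw [hsplit]
    cases K with
    | zero =>
      have hn : (n + 1 : ℂ) ≠ 0 := by exact_mod_cast n.succ_ne_zero
      -- By absorption `C(n,j)/(j+1) = C(n+1,j+1)/(n+1)`, which reduces the sum to the expansion of
      -- `(1-1)^(n+1)`.
      rw [cast_harmonic_succ, Finset.sum_congr rfl (g := fun j =>
        ((n : ℂ) + 1)⁻¹ * ((-1) ^ j * ((n + 1).choose (j + 1) : ℂ))) fun j _ => by
          have hj : (j + 1 : ℂ) ≠ 0 := by exact_mod_cast j.succ_ne_zero
          have := cast_choose_succ_mul n j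
          rw [zero_add]
          field_simp
          linear_combination this,
        ← Finset.mul_sum, sum_range_neg_one_pow_mul_choose_succ]
      simp
      ring
    | succ K =>
      rw [Finset.sum_range_succ, Nat.choose_eq_zero_of_lt (by omega : n < K + 1 + n), ih,
        cast_harmonic_succ, cast_harmonic_succ]
      have h1 := cast_choose_succ_mul n K
      have hM : (n + 1 : ℂ) ≠ 0 := by exact_mod_cast n.succ_ne_zero
      have hN : (K + 1 : ℂ) ≠ 0 := by exact_mod_cast K.succ_ne_zero
      have h2 : ((n + 1).choose (K + 1) : ℂ) * ((n : ℂ) + 1)⁻¹ = n.choose K * ((K : ℂ) + 1)⁻¹ := by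
        field_simp
        linear_combination -h1
      rw [Nat.choose_succ_succ] at h2 ⊢
      push_cast at h2 ⊢
      linear_combination -h2

theorem sum_Ico_neg_one_pow_mul_choose_div (n K : ℕ) (hK : K < n + 1) :
    ∑ q ∈ Finset.Ico (K + 1) (n + 1), (-1) ^ (n - q) * (n.choose q : ℂ) / ((q - 1 - K : ℕ) + 1) =
      -((-1) ^ (n - K) * n.choose K * (harmonic n - harmonic K)) := by
  rw [mul_assoc, ← sum_range_neg_one_pow_mul_choose_div_succ, Finset.sum_Ico_eq_sum_range,
    Nat.add_sub_add_right, Finset.mul_sum, ← Finset.sum_neg_distrib]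
  refine (Finset.sum_congr rfl fun j hj => ?_).trans
    (Finset.sum_subset (Finset.range_mono (Nat.sub_le n K)) fun j _ hj => ?_)
  · rw [Finset.mem_range] at hj
    obtain ⟨d, rfl⟩ : ∃ d, n = K + 1 + j + d := ⟨n - (K + 1 + j), by omega⟩
    rw [show K + 1 + j + d - (K + 1 + j) = d by omega, show K + 1 + j + d - K = j + d + 1 by omega,
      show K + 1 + j - 1 - K = j by omega]
    have : ((-1 : ℂ) ^ j) * (-1) ^ j = 1 := by rw [← mul_pow]; simp
    simp only [pow_succ, pow_add]
    linear_combination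
      -(-1) ^ d * ((K + 1 + j + d).choose (K + 1 + j) : ℂ) / ((j : ℂ) + 1) * this
  · rw [Finset.mem_range] at hj
    rw [Nat.choose_eq_zero_of_lt (by omega)]
    simp

theorem digamma_natCast_add_one (n : ℕ) :
    Complex.digamma ((n : ℂ) + 1) = harmonic n - Real.eulerMascheroniConstant := by
  induction n with
  | zero => simp [Complex.digamma_one]
  | succ n ih =>
    rw [Nat.cast_succ, Complex.digamma_apply_add_one, ih, cast_harmonic_succ]
    · ring
    · intro m hm
      have : (n : ℂ) + 1 + m = 0 := by rw [hm]; ring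
      exact absurd this (by exact_mod_cast (by omega : n + 1 + m ≠ 0))

theorem eval_ascPochhammer_natCast_add_one (m n : ℕ) :
    (ascPochhammer ℂ m).eval ((n : ℂ) + 1) = (n + m)! / n ! := by
  induction m with
  | zero => simp [Nat.factorial_ne_zero]
  | succ m ih =>
    rw [ascPochhammer_succ_eval, ih, ← add_assoc, Nat.factorial_succ]
    push_cast
    ring

theorem hasDerivAt_eval_ascPochhammer_add_one (m n : ℕ) :
    HasDerivAt (fun ν : ℂ => (ascPochhammer ℂ m).eval (ν + 1))
      ((n + m)! / n ! * (harmonic (n + m) - harmonic n)) n := by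
  induction m with
  | zero => simpa using hasDerivAt_const (n : ℂ) (1 : ℂ)
  | succ m ih =>
    simp only [ascPochhammer_succ_eval]
    refine (ih.fun_mul (((hasDerivAt_id (n : ℂ)).add_const 1).add_const (m : ℂ))).congr_deriv ?_
    rw [eval_ascPochhammer_natCast_add_one, ← add_assoc, Nat.factorial_succ, cast_harmonic_succ]
    have hn : (n + m + 1 : ℂ) ≠ 0 := by exact_mod_cast (n + m).succ_ne_zero
    push_cast
    simp only [id]
    field_simp
    ring

end HarmonicSums

/-! ### Moments of `s^n (s-1)^n` with and without a logarithm. -/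

section Kernel

variable {c w : ℂ} {R : ℝ}

theorem pow_mul_sub_one_pow (n : ℕ) (s : ℂ) :
    s ^ n * (s - 1) ^ n =
      ∑ q ∈ Finset.range (n + 1), (-1) ^ (n - q) * (n.choose q : ℂ) * s ^ (n + q) := by
  rw [sub_eq_add_neg, add_pow, Finset.mul_sum]
  refine Finset.sum_congr rfl fun q _ => ?_
  rw [pow_add]
  ring

theorem cauchyMoment_pow_mul_sub_one_pow_mul (hw : w ∈ ball c R) (n N : ℕ) {f : ℂ → ℂ}
    (hf : ContinuousOn f (sphere c R)) :
    cauchyMoment c R w N (fun s => s ^ n * (s - 1) ^ n * f s) =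
      ∑ q ∈ Finset.range (n + 1), (-1) ^ (n - q) * (n.choose q : ℂ) *
        cauchyMoment c R w N (fun s => s ^ (n + q) * f s) := by
  simp only [pow_mul_sub_one_pow, Finset.sum_mul, mul_assoc]
  rw [cauchyMoment_sum hw _ _ fun q _ => by fun_prop]
  simp only [cauchyMoment_const_mul]

theorem cauchyMoment_kernel (hw : w ∈ ball c R) (n N : ℕ) :
    cauchyMoment c R w N (fun s => s ^ n * (s - 1) ^ n) =
      ∑ q ∈ Finset.range (n + 1), (-1) ^ (n - q) * (n.choose q : ℂ) *
        ((n + q).choose N * w ^ (n + q - N)) := by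
  have := cauchyMoment_pow_mul_sub_one_pow_mul hw n N (f := fun _ => 1) continuousOn_const
  simpa only [mul_one, cauchyMoment_pow hw] using this

theorem choose_mul_pow_sub_mul_pow {M N i : ℕ} (hi : i < M) :
    ((M - 1 - i).choose N : ℂ) * w ^ (M - 1 - i - N) * w ^ (i + 1) =
      (M - 1 - i).choose N * w ^ (M - N) := by
  rcases lt_or_ge (M - 1 - i) N with h | h
  · simp [Nat.choose_eq_zero_of_lt h]
  · rw [mul_assoc, ← pow_add, show M - 1 - i - N + (i + 1) = M - N by omega]

theorem cauchyMoment_kernel_mul_log_div_sub (h1 : (1 : ℂ) ∈ ball c R) (hw : w ∈ ball c R)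
    (n N : ℕ) (hN : n ≤ N) :
    cauchyMoment c R w N (fun s => s ^ n * (s - 1) ^ n * Complex.log ((s - 1) / (s - w))) =
      ∑ q ∈ Finset.range (n + 1), (-1) ^ (n - q) * (n.choose q : ℂ) *
        ((n + q).choose N * w ^ (n + q - N)) *
          (harmonic (n + q) - harmonic N + harmonic n - harmonic q) := by
  rw [cauchyMoment_pow_mul_sub_one_pow_mul hw n N (continuousOn_log_div_sub h1 hw)]
  have e1 : ∀ q, cauchyMoment c R w N (fun s => s ^ (n + q) * Complex.log ((s - 1) / (s - w))) =
      (n + q).choose N * (harmonic (n + q) - harmonic N) * w ^ (n + q - N) -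
        ∑ K ∈ Finset.Ico 0 q, ((n + K).choose N * w ^ (n + K - N)) / ((q - 1 - K : ℕ) + 1) := by
    intro q
    rw [cauchyMoment_pow_mul_log_div_sub h1 hw, ← sum_range_choose_div_succ, Finset.sum_mul]
    -- Here `K = q-1-i`. The indices `i ≥ q` drop out because then `n+q-1-i < n ≤ N` and the
    -- binomial coefficient vanishes.
    have e2 : ∑ K ∈ Finset.Ico 0 q, ((n + K).choose N * w ^ (n + K - N)) / ((q - 1 - K : ℕ) + 1) =
        ∑ i ∈ Finset.range (n + q),
          (((n + q - 1 - i).choose N : ℂ) * w ^ (n + q - 1 - i - N)) / (i + 1) := by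
      rw [← Finset.range_eq_Ico, ← Finset.sum_range_reflect]
      refine (Finset.sum_congr rfl fun i hi => ?_).trans
        (Finset.sum_subset (Finset.range_mono (Nat.le_add_left q n)) fun i hi hi' => ?_)
      · rw [Finset.mem_range] at hi
        rw [show n + (q - 1 - i) = n + q - 1 - i by omega, show q - 1 - (q - 1 - i) = i by omega]
      · rw [Finset.mem_range] at hi hi'
        rw [Nat.choose_eq_zero_of_lt (by omega)]
        simp
    rw [e2, ← Finset.sum_sub_distrib]
    refine Finset.sum_congr rfl fun i hi => ?_
    have := choose_mul_pow_sub_mul_pow (w := w) (N := N) (Finset.mem_range.1 hi)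
    rw [one_pow]
    linear_combination this / ((i : ℂ) + 1)
  simp only [e1, mul_sub, Finset.sum_sub_distrib, Finset.mul_sum]
  -- Summing over the triangle `K < q` in the other order collects the coefficient of each power of
  -- `w` as an alternating sum over `q`, which `sum_Ico_neg_one_pow_mul_choose_div` evaluates.
  have e3 := Finset.sum_Ico_Ico_comm' 0 (n + 1) fun K q =>
    (-1) ^ (n - q) * (n.choose q : ℂ) *
      (((n + K).choose N * w ^ (n + K - N)) / ((q - 1 - K : ℕ) + 1))
  rw [Finset.range_eq_Ico, ← e3, ← Finset.sum_sub_distrib, ← Finset.sum_sub_distrib]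
  refine Finset.sum_congr rfl fun q hq => ?_
  have e4 := sum_Ico_neg_one_pow_mul_choose_div n q (Finset.mem_Ico.1 hq).2
  have e5 : ∑ j ∈ Finset.Ico (q + 1) (n + 1), (-1) ^ (n - j) * (n.choose j : ℂ) *
      (((n + q).choose N * w ^ (n + q - N)) / ((j - 1 - q : ℕ) + 1)) =
      ((n + q).choose N * w ^ (n + q - N)) * ∑ j ∈ Finset.Ico (q + 1) (n + 1),
        (-1) ^ (n - j) * (n.choose j : ℂ) / ((j - 1 - q : ℕ) + 1) := by
    rw [Finset.mul_sum]
    refine Finset.sum_congr rfl fun j _ => ?_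
    ring
  rw [e5, e4]
  ring

theorem cauchyMoment_kernel_mul_log (hw : w ∈ ball c R) (hS : closedBall c R ⊆ Complex.slitPlane)
    (n m : ℕ) (hmn : m ≤ n) :
    cauchyMoment c R w (n + m) (fun s => s ^ n * (s - 1) ^ n * Complex.log s) =
      ∑ q ∈ Finset.range m, (-1) ^ (n - q) * (n.choose q : ℂ) *
        ((-1) ^ (m - 1 - q) * ((n + q)! * (m - q - 1)! / (n + m)!) / w ^ (m - q)) +
      ∑ k ∈ Finset.range (n - m + 1), (-1) ^ (n - (m + k)) * (n.choose (m + k) : ℂ) *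
        ((n + m + k).choose (n + m) * w ^ k *
          (Complex.log w + harmonic (n + m + k) - harmonic k)) := by
  have hlog : ContinuousOn Complex.log (sphere c R) := fun s hs =>
    (continuousAt_clog (hS (sphere_subset_closedBall hs))).continuousWithinAt
  rw [cauchyMoment_pow_mul_sub_one_pow_mul hw n _ hlog, show n + 1 = m + (n - m + 1) by omega,
    Finset.sum_range_add]
  congr 1
  · refine Finset.sum_congr rfl fun q hq => ?_
    rw [Finset.mem_range] at hq
    have := cauchyMoment_add_pow_mul_log hw hS (n + q) (m - 1 - q)
    rw [show n + q + 1 + (m - 1 - q) = n + m by omega, show m - 1 - q + 1 = m - q by omega] at this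
    rw [this, Nat.sub_right_comm]
  · refine Finset.sum_congr rfl fun k _ => ?_
    rw [← add_assoc, cauchyMoment_pow_add_mul_log hw hS]

/-- For `q < m` the exponent `n+q` is below the order `n+m`, so only `q = m+k` survives. -/
theorem sum_range_kernel (n m : ℕ) (hmn : m ≤ n) (f : ℕ → ℂ) :
    ∑ q ∈ Finset.range (n + 1), (-1) ^ (n - q) * (n.choose q : ℂ) *
        ((n + q).choose (n + m) * w ^ (n + q - (n + m))) * f q =
      ∑ k ∈ Finset.range (n - m + 1), (-1) ^ (n - (m + k)) * (n.choose (m + k) : ℂ) *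
        ((n + m + k).choose (n + m) * w ^ k) * f (m + k) := by
  rw [show n + 1 = m + (n - m + 1) by omega, Finset.sum_range_add, Finset.sum_eq_zero, zero_add]
  · refine Finset.sum_congr rfl fun k _ => ?_
    rw [← add_assoc, Nat.add_sub_cancel_left]
  · intro q hq
    rw [Finset.mem_range] at hq
    rw [Nat.choose_eq_zero_of_lt (by omega : n + q < n + m)]
    simp

end Kernel

/-! ### Schläfli's integral: substitution, derivative in the degree, branches of powers. -/

section Legendre

/-- A point of the disc on the cut would put `0` on its segment to `1`, hence in the disc by
convexity. -/
theorem closedBall_subset_slitPlane {c : ℂ} {R : ℝ} (h1 : (1 : ℂ) ∈ closedBall c R)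
    (h0 : (0 : ℂ) ∉ closedBall c R) : closedBall c R ⊆ Complex.slitPlane := by
  intro s hs
  rw [Complex.mem_slitPlane_iff_not_le_zero]
  intro h
  obtain ⟨hre, him⟩ := Complex.le_def.1 h
  obtain ⟨x, hx⟩ : ∃ x : ℝ, x = -s.re := ⟨_, rfl⟩
  have hx0 : 0 ≤ x := by simp only [Complex.zero_re] at hre; linarith
  have hs' : s = -(x : ℂ) := by
    apply Complex.ext
    · simp [hx]
    · simpa using him
  have hx1 : (1 + x : ℂ) ≠ 0 := by exact_mod_cast (by positivity : (1 + x) ≠ 0)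
  have hmem : (1 / (1 + x)) • s + (x / (1 + x)) • (1 : ℂ) ∈ closedBall c R :=
    convex_closedBall c R hs h1 (by positivity) (by positivity) (by field_simp)
  refine h0 ?_
  convert hmem using 1
  simp only [Complex.real_smul, hs']
  push_cast
  field_simp
  ring

theorem circleIntegral_comp_add_one_div_two (c : ℂ) (R : ℝ) (f : ℂ → ℂ) :
    ∮ t in C(c, R), f ((t + 1) / 2) = 2 * ∮ s in C((c + 1) / 2, R / 2), f s := by
  simp only [circleIntegral, ← intervalIntegral.integral_const_mul]
  congr 1
  ext θ
  have : circleMap ((c + 1) / 2) (R / 2) θ = (circleMap c R θ + 1) / 2 := by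
    simp only [circleMap]
    push_cast
    ring
  rw [this, deriv_circleMap, deriv_circleMap]
  simp only [circleMap, smul_eq_mul]
  push_cast
  ring

theorem add_one_div_two_mem_ball {c t : ℂ} {R : ℝ} :
    (t + 1) / 2 ∈ ball ((c + 1) / 2) (R / 2) ↔ t ∈ ball c R := by
  rw [mem_ball, mem_ball, dist_eq_norm, dist_eq_norm,
    show (t + 1) / 2 - (c + 1) / 2 = (t - c) / 2 by ring, norm_div, Complex.norm_ofNat]
  exact div_lt_div_iff_of_pos_right two_pos

theorem add_one_div_two_mem_closedBall {c t : ℂ} {R : ℝ} :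
    (t + 1) / 2 ∈ closedBall ((c + 1) / 2) (R / 2) ↔ t ∈ closedBall c R := by
  rw [mem_closedBall, mem_closedBall, dist_eq_norm, dist_eq_norm,
    show (t + 1) / 2 - (c + 1) / 2 = (t - c) / 2 by ring, norm_div, Complex.norm_ofNat]
  exact div_le_div_iff_of_pos_right two_pos

theorem add_one_div_two_mem_sphere {c t : ℂ} {R : ℝ} (ht : t ∈ sphere c R) :
    (t + 1) / 2 ∈ sphere ((c + 1) / 2) (R / 2) := by
  rw [mem_sphere, dist_eq_norm] at ht ⊢
  rw [show (t + 1) / 2 - (c + 1) / 2 = (t - c) / 2 by ring, norm_div, Complex.norm_ofNat, ht]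

/-- Schläfli's integral at a natural degree, with an extra factor `f`, as a Cauchy integral in the
variable `(t + 1) / 2`. -/
theorem schlaefli_natCast {c z : ℂ} {R : ℝ} (hz : z ∈ ball c R) (n m : ℕ) (f : ℂ → ℂ) :
    (2 * (Real.pi : ℂ) * Complex.I)⁻¹ * ∮ t in C(c, R),
      ((t + 1) / 2) ^ (n : ℂ) * ((t - 1) / (t - z)) ^ (n : ℂ) / (t - z) ^ (m + 1) *
        f ((t + 1) / 2) =
    cauchyMoment ((c + 1) / 2) (R / 2) ((z + 1) / 2) (n + m)
      (fun s => s ^ n * (s - 1) ^ n * f s) / 2 ^ m := by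
  have h := circleIntegral_comp_add_one_div_two c R fun s =>
    s ^ n * (s - 1) ^ n * f s / (s - (z + 1) / 2) ^ (n + m + 1)
  unfold cauchyMoment
  rw [mul_div_assoc]
  congr 1
  rw [eq_div_iff (pow_ne_zero m two_ne_zero), ← mul_right_inj' (two_ne_zero (α := ℂ)), ← h,
    mul_comm _ (2 ^ m : ℂ), ← mul_assoc, ← circleIntegral.integral_const_mul]
  refine circleIntegral.integral_congr (radius_nonneg_of_mem_ball hz) fun t ht => ?_
  have hne := sub_ne_zero_of_mem_sphere hz ht
  simp only [Complex.cpow_natCast]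
  rw [show (t + 1) / 2 - 1 = (t - 1) / 2 by ring,
    show (t + 1) / 2 - (z + 1) / 2 = (t - z) / 2 by ring]
  simp only [div_pow, pow_add, pow_one]
  field_simp

theorem hasDerivAt_schlaefli {c z : ℂ} {R : ℝ} (h1 : (1 : ℂ) ∈ ball c R) (hz : z ∈ ball c R)
    (h0 : (-1 : ℂ) ∉ closedBall c R) (m : ℕ) (ν₀ : ℂ) :
    HasDerivAt (fun ν => ∮ t in C(c, R),
        ((t + 1) / 2) ^ ν * ((t - 1) / (t - z)) ^ ν / (t - z) ^ (m + 1))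
      (∮ t in C(c, R), ((t + 1) / 2) ^ ν₀ * ((t - 1) / (t - z)) ^ ν₀ / (t - z) ^ (m + 1) *
        (Complex.log ((t + 1) / 2) + Complex.log ((t - 1) / (t - z)))) ν₀ := by
  have hR := radius_nonneg_of_mem_ball hz
  have hA : ∀ t ∈ sphere c R, (t + 1) / 2 ∈ Complex.slitPlane := by
    intro t ht
    refine closedBall_subset_slitPlane (c := (c + 1) / 2) (R := R / 2) ?_ ?_
      (sphere_subset_closedBall (add_one_div_two_mem_sphere ht))
    · have := add_one_div_two_mem_closedBall.2 (ball_subset_closedBall h1)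
      norm_num at this ⊢
      exact this
    · intro h
      refine h0 (add_one_div_two_mem_closedBall.1 ?_)
      simpa using h
  have hB : ∀ t ∈ sphere c R, (t - 1) / (t - z) ∈ Complex.slitPlane := fun t ht =>
    div_sub_mem_slitPlane h1 hz ht
  have hne : ∀ t ∈ sphere c R, t - z ≠ 0 := fun t ht => sub_ne_zero_of_mem_sphere hz ht
  have hA' : ContinuousOn (fun x : ℂ × ℂ => (x.2 + 1) / 2) (univ ×ˢ sphere c R) := by fun_prop
  have hB' : ContinuousOn (fun x : ℂ × ℂ => (x.2 - 1) / (x.2 - z)) (univ ×ˢ sphere c R) :=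
    ContinuousOn.div (by fun_prop) (by fun_prop) fun x hx => hne _ hx.2
  have hF : ContinuousOn (fun x : ℂ × ℂ => ((x.2 + 1) / 2) ^ x.1 *
      ((x.2 - 1) / (x.2 - z)) ^ x.1 / (x.2 - z) ^ (m + 1)) (univ ×ˢ sphere c R) :=
    ((hA'.cpow continuousOn_fst fun x hx => hA _ hx.2).mul
      (hB'.cpow continuousOn_fst fun x hx => hB _ hx.2)).div (by fun_prop)
      fun x hx => pow_ne_zero (m + 1) (hne _ hx.2)
  refine hasDerivAt_circleIntegral hR isOpen_univ (mem_univ ν₀)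
    (F := fun ν t => ((t + 1) / 2) ^ ν * ((t - 1) / (t - z)) ^ ν / (t - z) ^ (m + 1))
    (F' := fun ν t => ((t + 1) / 2) ^ ν * ((t - 1) / (t - z)) ^ ν / (t - z) ^ (m + 1) *
        (Complex.log ((t + 1) / 2) + Complex.log ((t - 1) / (t - z)))) hF
    (hF.mul ((hA'.clog fun x hx => hA _ hx.2).add (hB'.clog fun x hx => hB _ hx.2))) ?_
  intro ν _ t ht
  have hd : ∀ a ∈ Complex.slitPlane, HasDerivAt (fun ν : ℂ => a ^ ν) (a ^ ν * Complex.log a) ν :=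
    fun a ha => by
      simpa using (hasDerivAt_id ν).const_cpow (Or.inl (Complex.slitPlane_ne_zero ha))
  refine (((hd _ (hA t ht)).fun_mul (hd _ (hB t ht))).div_const _).congr_deriv ?_
  ring

theorem div_cpow_of_arg_sub_mem {x y : ℂ} (hx : x ≠ 0) (hy : y ≠ 0)
    (h : x.arg - y.arg ∈ Ioo (-Real.pi) Real.pi) (a : ℂ) : (x / y) ^ a = x ^ a / y ^ a := by
  have hlog : Complex.log (x / y) = Complex.log x - Complex.log y := by
    rw [← Complex.log_exp (x := Complex.log x - Complex.log y), Complex.exp_sub,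
      Complex.exp_log hx, Complex.exp_log hy]
    · simpa [Complex.log_im] using h.1
    · simpa [Complex.log_im] using h.2.le
  rw [Complex.cpow_def_of_ne_zero (div_ne_zero hx hy), Complex.cpow_def_of_ne_zero hx,
    Complex.cpow_def_of_ne_zero hy, hlog, sub_mul, Complex.exp_sub]

/-- The numbers `z-1` and `z+1` have the same imaginary part, so their arguments lie both in
`(0,π)`, both in `(-π,0)`, or are both `0`. Their difference stays in `(-π,π)` and no branch jump
occurs. -/
theorem div_cpow_sub_one_add_one {z : ℂ} (hz : ∀ x : ℝ, x ≤ 1 → z ≠ (x : ℂ)) (a : ℂ) :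
    ((z - 1) / (z + 1)) ^ a = (z - 1) ^ a / (z + 1) ^ a := by
  have h1 : z - 1 ≠ 0 := fun h => hz 1 le_rfl (by push_cast; linear_combination h)
  have h2 : z + 1 ≠ 0 := fun h => hz (-1) (by norm_num) (by push_cast; linear_combination h)
  refine div_cpow_of_arg_sub_mem h1 h2 ?_ a
  have e1 : (z - 1).im = z.im := by simp
  have e2 : (z + 1).im = z.im := by simp
  have hpi := Real.pi_pos
  rcases lt_trichotomy z.im 0 with h | h | h
  · have a1 := Complex.arg_neg_iff.2 (e1 ▸ h)
    have a2 := Complex.arg_neg_iff.2 (e2 ▸ h)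
    have b1 := Complex.neg_pi_lt_arg (z - 1)
    have b2 := Complex.neg_pi_lt_arg (z + 1)
    constructor <;> linarith
  · have hre : 1 < z.re := by
      by_contra! hle
      exact hz z.re hle (Complex.ext (by simp) (by simp [h]))
    rw [Complex.arg_eq_zero_iff.2 ⟨by simp; linarith, by rw [e1, h]⟩,
      Complex.arg_eq_zero_iff.2 ⟨by simp; linarith, by rw [e2, h]⟩]
    constructor <;> linarith
  · have a1 : 0 < (z - 1).arg := (Complex.arg_nonneg_iff.2 (e1 ▸ h.le)).lt_of_ne fun h0 => by
      have := (Complex.arg_eq_zero_iff.1 h0.symm).2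
      rw [e1] at this
      exact h.ne' this
    have a2 : 0 < (z + 1).arg := (Complex.arg_nonneg_iff.2 (e2 ▸ h.le)).lt_of_ne fun h0 => by
      have := (Complex.arg_eq_zero_iff.1 h0.symm).2
      rw [e2] at this
      exact h.ne' this
    have b1 : (z - 1).arg < Real.pi := Complex.arg_lt_pi_iff.2 (Or.inr (by rw [e1]; exact h.ne'))
    have b2 : (z + 1).arg < Real.pi := Complex.arg_lt_pi_iff.2 (Or.inr (by rw [e2]; exact h.ne'))
    constructor <;> linarith

/-- The factor `((z+1)/2)^m` extracted here turns the negative powers `((z+1)/2)^(q-m)` from the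
moments of `log s` into the powers `((z+1)/2)^q` of the first sum. -/
theorem sqSubOnePow_eq {z : ℂ} (hz : ∀ x : ℝ, x ≤ 1 → z ≠ (x : ℂ)) (m : ℕ) :
    sqSubOnePow m z / 2 ^ m = ((z - 1) / (z + 1)) ^ ((m : ℂ) / 2) * ((z + 1) / 2) ^ m := by
  have h2 : z + 1 ≠ 0 := fun h => hz (-1) (by norm_num) (by push_cast; linear_combination h)
  have h : (z + 1) ^ ((m : ℂ) / 2) * (z + 1) ^ ((m : ℂ) / 2) = (z + 1) ^ m := by
    rw [← Complex.cpow_add _ _ h2, add_halves, Complex.cpow_natCast]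
  have h3 : (z + 1) ^ ((m : ℂ) / 2) ≠ 0 := by simp [Complex.cpow_eq_zero_iff, h2]
  rw [div_cpow_sub_one_add_one hz, sqSubOnePow, div_pow, ← h]
  field_simp

end Legendre

/-! ### The derivative at an integer degree, in harmonic numbers. -/

section Degree

theorem assocLegendreP_natCast {z : ℂ} (hz : ∀ x : ℝ, x ≤ 1 → z ≠ (x : ℂ)) (n m : ℕ) :
    assocLegendreP n m z = (n + m)! / n ! * sqSubOnePow m z *
      (cauchyMoment ((legendreCenter z + 1) / 2) (legendreRadius z / 2) ((z + 1) / 2) (n + m)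
        (fun s => s ^ n * (s - 1) ^ n) / 2 ^ m) := by
  obtain ⟨-, h, -⟩ := legendreCircle_spec z fun x hx => hz x (by linarith)
  have := schlaefli_natCast h n m fun _ => 1
  simp only [mul_one] at this
  rw [assocLegendreP, this, eval_ascPochhammer_natCast_add_one]

theorem hasDerivAt_assocLegendreP {z : ℂ} (hz : ∀ x : ℝ, x ≤ 1 → z ≠ (x : ℂ)) (n m : ℕ)
    (hmn : m ≤ n) :
    HasDerivAt (fun ν : ℂ => assocLegendreP ν m z)
      (assocLegendreP (n : ℂ) m z * Complex.log ((z + 1) / 2) +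
        (n + m)! / n ! * (sqSubOnePow m z / 2 ^ m) *
          (∑ q ∈ Finset.range m, (-1) ^ (n - q) * (n.choose q : ℂ) *
            ((-1) ^ (m - 1 - q) * ((n + q)! * (m - q - 1)! / (n + m)!) /
              ((z + 1) / 2) ^ (m - q)) +
          ∑ k ∈ Finset.range (n - m + 1), (-1) ^ (n - (m + k)) * (n.choose (m + k) : ℂ) *
            ((n + m + k).choose (n + m) * ((z + 1) / 2) ^ k) *
              (2 * harmonic (n + m + k) - harmonic (m + k) - harmonic k))) n := by
  obtain ⟨h1, hzb, h0⟩ := legendreCircle_spec z fun x hx => hz x (by linarith)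
  have hwb := add_one_div_two_mem_ball.2 hzb
  have h1b := add_one_div_two_mem_ball.2 h1
  have h0b := mt add_one_div_two_mem_closedBall.1 h0
  have hder := hasDerivAt_schlaefli h1 hzb h0 m n
  have hval := assocLegendreP_natCast hz n m
  have hint := schlaefli_natCast hzb n m fun s =>
    Complex.log s + Complex.log ((s - 1) / (s - (z + 1) / 2))
  have hint1 := schlaefli_natCast hzb n m fun _ => 1
  rw [show ((1 : ℂ) + 1) / 2 = 1 by norm_num] at h1b
  rw [show (-1 + 1 : ℂ) / 2 = 0 by norm_num] at h0b
  simp only [mul_one] at hint1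
  unfold assocLegendreP at hval ⊢
  generalize legendreCenter z = c at *
  generalize legendreRadius z = R at *
  generalize hw : (z + 1) / 2 = w at hwb hval hint hint1 ⊢
  have hS := closedBall_subset_slitPlane (ball_subset_closedBall h1b) h0b
  have hlog : ContinuousOn Complex.log (sphere ((c + 1) / 2) (R / 2)) := fun s hs =>
    (continuousAt_clog (hS (sphere_subset_closedBall hs))).continuousWithinAt
  have hL := continuousOn_log_div_sub h1b hwb
  have hratio : ∀ t : ℂ, ((t + 1) / 2 - 1) / ((t + 1) / 2 - w) = (t - 1) / (t - z) := fun t => by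
    rw [← hw, show (t + 1) / 2 - 1 = (t - 1) / 2 by ring,
      show (t + 1) / 2 - (z + 1) / 2 = (t - z) / 2 by ring, div_div_div_cancel_right₀ two_ne_zero]
  simp only [hratio, mul_add] at hint
  rw [cauchyMoment_add hwb _ (by fun_prop) (by fun_prop), cauchyMoment_kernel_mul_log hwb hS n m hmn,
    cauchyMoment_kernel_mul_log_div_sub h1b hwb n _ (Nat.le_add_right n m),
    sum_range_kernel n m hmn fun q => harmonic (n + q) - harmonic (n + m) + harmonic n - harmonic q]
    at hint
  have hM := cauchyMoment_kernel hwb n (n + m)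
  have hM' := sum_range_kernel (w := w) n m hmn fun _ => 1
  simp only [mul_one] at hM'
  rw [hM'] at hM
  rw [hM] at hint1 hval
  have hfin := ((hasDerivAt_eval_ascPochhammer_add_one m n).mul_const (sqSubOnePow m z)).fun_mul
    (hder.const_mul (2 * (Real.pi : ℂ) * Complex.I)⁻¹)
  simp only [mul_add] at hfin hint
  refine hfin.congr_deriv ?_
  rw [hint, hval, hint1, eval_ascPochhammer_natCast_add_one]
  -- The three sums come from `log s`, from `log ((s-1)/(s-w))`, and from the Pochhammer derivative
  -- together with the term `P_n^m(z) log w` moved across. The numbers `H_(n+m)`, `H_n` and `log w`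
  -- cancel.
  have hsum : ∀ g : ℕ → ℂ,
      ∑ k ∈ Finset.range (n - m + 1), g k *
        (2 * harmonic (n + m + k) - harmonic (m + k) - harmonic k) =
      ∑ k ∈ Finset.range (n - m + 1), g k *
          (Complex.log w + harmonic (n + m + k) - harmonic k) +
        ∑ k ∈ Finset.range (n - m + 1), g k *
          (harmonic (n + (m + k)) - harmonic (n + m) + harmonic n - harmonic (m + k)) +
        (harmonic (n + m) - harmonic n - Complex.log w) *
          ∑ k ∈ Finset.range (n - m + 1), g k := fun g => by
    rw [Finset.mul_sum, ← Finset.sum_add_distrib, ← Finset.sum_add_distrib]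
    refine Finset.sum_congr rfl fun k _ => ?_
    rw [add_assoc n m k]
    ring
  rw [hsum]
  simp only [mul_assoc]
  ring

end Degree

/-! ### The closed form with factorials and digamma values. -/

theorem mainTheorem3 (n : ℕ) (z : ℂ) (hz : ∀ x : ℝ, x ≤ 1 → z ≠ (x : ℂ)) :
    (∀ m : ℕ, m ≤ n →
      HasDerivAt (fun ν : ℂ => assocLegendreP ν m z)
        (assocLegendreP (n : ℂ) m z * Complex.log ((z + 1) / 2)
          - (-1) ^ (n + m) * ((z - 1) / (z + 1)) ^ ((m : ℂ) / 2) *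
              ∑ k ∈ Finset.range m,
                (((k + n)! : ℂ) * ((m - k - 1)! : ℂ)) / ((k ! : ℂ) * ((n - k)! : ℂ)) *
                  ((z + 1) / 2) ^ k
          + (-1) ^ (n + m) * (sqSubOnePow m z / 2 ^ m) *
              ∑ k ∈ Finset.range (n - m + 1),
                (-1) ^ k * (((k + n + m)! : ℂ) /
                    ((k ! : ℂ) * ((k + m)! : ℂ) * ((n - m - k)! : ℂ))) *
                  (2 * Complex.digamma ((k : ℂ) + n + m + 1)
                    - Complex.digamma ((k : ℂ) + m + 1) - Complex.digamma ((k : ℂ) + 1)) *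
                  ((z + 1) / 2) ^ k)
        (n : ℂ)) ∧
    HasDerivAt (fun ν : ℂ => legendreP ν z)
      (legendreP (n : ℂ) z * Complex.log ((z + 1) / 2)
        + 2 * ∑ k ∈ Finset.range (n + 1),
            (-1) ^ (k + n) * (((k + n)! : ℂ) / ((k ! : ℂ) ^ 2 * ((n - k)! : ℂ))) *
              (Complex.digamma ((k : ℂ) + n + 1) - Complex.digamma ((k : ℂ) + 1)) *
              ((z + 1) / 2) ^ k)
      (n : ℂ) := by
  have h2 : (z + 1) / 2 ≠ 0 := fun h =>
    hz (-1) (by norm_num) (by push_cast; linear_combination 2 * h)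
  have main : ∀ m : ℕ, m ≤ n →
      HasDerivAt (fun ν : ℂ => assocLegendreP ν m z)
        (assocLegendreP (n : ℂ) m z * Complex.log ((z + 1) / 2)
          - (-1) ^ (n + m) * ((z - 1) / (z + 1)) ^ ((m : ℂ) / 2) *
              ∑ k ∈ Finset.range m,
                (((k + n)! : ℂ) * ((m - k - 1)! : ℂ)) / ((k ! : ℂ) * ((n - k)! : ℂ)) *
                  ((z + 1) / 2) ^ k
          + (-1) ^ (n + m) * (sqSubOnePow m z / 2 ^ m) *
              ∑ k ∈ Finset.range (n - m + 1),
                (-1) ^ k * (((k + n + m)! : ℂ) /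
                    ((k ! : ℂ) * ((k + m)! : ℂ) * ((n - m - k)! : ℂ))) *
                  (2 * Complex.digamma ((k : ℂ) + n + m + 1)
                    - Complex.digamma ((k : ℂ) + m + 1) - Complex.digamma ((k : ℂ) + 1)) *
                  ((z + 1) / 2) ^ k)
        (n : ℂ) := by
    intro m hmn
    refine (hasDerivAt_assocLegendreP hz n m hmn).congr_deriv ?_
    have hfac : ∀ j : ℕ, (j ! : ℂ) ≠ 0 := fun j => by exact_mod_cast j.factorial_ne_zero
    rw [mul_add, ← add_assoc, sub_eq_add_neg]
    congr 1
    · congr 1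
      rw [sqSubOnePow_eq hz, Finset.mul_sum, Finset.mul_sum, ← Finset.sum_neg_distrib]
      refine Finset.sum_congr rfl fun k hk => ?_
      rw [Finset.mem_range] at hk
      obtain ⟨j, rfl⟩ : ∃ j, m = k + 1 + j := ⟨m - (k + 1), by omega⟩
      obtain ⟨d, rfl⟩ : ∃ d, n = k + d := ⟨n - k, by omega⟩
      generalize ((z - 1) / (z + 1)) ^ (((k + 1 + j : ℕ) : ℂ) / 2) = A
      generalize (z + 1) / 2 = w at h2 ⊢
      rw [Nat.cast_add_choose, show k + 1 + j - 1 - k = j by omega,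
        show k + 1 + j - k - 1 = j by omega, show k + 1 + j - k = j + 1 by omega,
        Nat.add_sub_cancel_left, show k + (k + d) = k + d + k by omega]
      have hk1 := hfac k
      have hk2 := hfac d
      have hk3 := hfac (k + d)
      have hk4 := hfac (k + d + (k + 1 + j))
      have hsq : ((-1 : ℂ) ^ k) * (-1) ^ k = 1 := by rw [← mul_pow]; simp
      simp only [pow_add (-1 : ℂ), pow_one]
      field_simp
      linear_combination -A * w ^ (k + 1 + j) * (k + d + k)! * j ! * hsq
    · rw [Finset.mul_sum, Finset.mul_sum]
      refine Finset.sum_congr rfl fun k hk => ?_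
      rw [Finset.mem_range] at hk
      obtain ⟨d, rfl⟩ : ∃ d, n = m + k + d := ⟨n - (m + k), by omega⟩
      -- Euler's constant cancels, since the digamma values enter with weights `2`, `-1`, `-1`.
      have e1 := digamma_natCast_add_one (m + k + d + m + k)
      have e2 := digamma_natCast_add_one (m + k)
      have e3 := digamma_natCast_add_one k
      rw [show (k : ℂ) + (m + k + d : ℕ) + m + 1 = ((m + k + d + m + k : ℕ) : ℂ) + 1 by
          push_cast; ring,
        show (k : ℂ) + m + 1 = ((m + k : ℕ) : ℂ) + 1 by push_cast; ring, e1, e2, e3,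
        Nat.cast_add_choose, Nat.cast_add_choose, Nat.add_sub_cancel_left,
        show m + k + d - m - k = d by omega, show k + (m + k + d) + m = m + k + d + m + k by omega,
        add_comm k m]
      have hk1 := hfac k
      have hk2 := hfac d
      have hk3 := hfac (m + k + d)
      have hk4 := hfac (m + k + d + m)
      have hk5 := hfac (m + k)
      have hsm : ((-1 : ℂ) ^ m) * (-1) ^ m = 1 := by rw [← mul_pow]; simp
      have hsk : ((-1 : ℂ) ^ k) * (-1) ^ k = 1 := by rw [← mul_pow]; simp
      -- With `n = m+k+d` this is the sign rule `(-1)^(n+m) (-1)^k = (-1)^(n-m-k)`.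
      have hsign : (-1 : ℂ) ^ (m + k + d + m) * (-1) ^ k = (-1) ^ d := by
        simp only [pow_add]
        linear_combination (-1 : ℂ) ^ d * (((-1 : ℂ) ^ k) * (-1) ^ k * hsm + hsk)
      rw [← hsign]
      field_simp
      ring
  refine ⟨main, ?_⟩
  refine (main 0 n.zero_le).congr_deriv ?_
  have hs : sqSubOnePow 0 z = 1 := by simp [sqSubOnePow]
  simp only [hs, Finset.range_zero, Finset.sum_empty, legendreP, pow_zero, div_one, mul_zero,
    sub_zero, mul_one, add_zero, Nat.sub_zero, Nat.cast_zero]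
  congr 1
  -- For `m = 0` the two subtracted digamma values coincide, which produces the common factor `2`.
  rw [Finset.mul_sum, Finset.mul_sum]
  refine Finset.sum_congr rfl fun k _ => ?_
  rw [pow_add]
  ring
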